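/- A Cantor space is a nonempty compact metrizable space with a countable basis of clopen sets and no isolated points. A continuous self-map $f$ of a topological space $Y$ is called mixing if for all nonempty open $U,V\subseteq Y$ there is $N\in\mathbb N$ such that $f^m(U)\cap V\neq\emptyset$ for all $m\ge N$. A Lelek fence over a Cantor space $\mathbf C$ is a subspace of $\mathbf C\times[0,1]$ of the form $\mathbf F=\{(x,t): x\in\mathbf C,\ 0\le t\le\varphi(x)\}$, where $\varphi:\mathbf C\to[0,1]$ is upper semicontinuous, $\varphi$ is positive on a dense subset of $\mathbf C$, and the graph of $\varphi$ is dense in $\mathbf F$. A map $T:\mathbf F\to\mathbf F$ is a lifting of $h:\mathbf C\to\mathbf C$ if for every $(x,t)\in\mathbf F$ one has $T(x,t)=(h(x),s)$ for some $s$. (1) Let $\mathbf C$ be a Cantor space and let $h:\mathbf C\to\mathbf C$ be a mixing homeomorphism such that for every pair of nonempty open sets $U,V\subseteq\mathbf C$ there exist a compact set $K_{U,V}\subseteq\mathbf C$ and $m(U,V)\in\mathbb N$ such that $K_{U,V}$ is nowhere dense in $\mathbf C$, $h(K_{U,V})=K_{U,V}$, and $h^m(K_{U,V}\cap U)\cap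 V\neq\emptyset$ for all $m\ge m(U,V)$. Then there are a Lelek fence $\mathbf F$ over $\mathbf C$ and a mixing homeomorphism $\hat h:\mathbf F\to\mathbf F$ which is a lifting of $h$. (2) For every integer $n\ge2$, the space $\{0,\dots,n-1\}^{\mathbb Z}$ is a Cantor space, and the shift $(\sigma x)_i=x_{i+1}$ on it is mixing and satisfies the hypotheses of (1). -/

import Mathlib

/-- A Cantor space: a nonempty compact metrizable space with a countable basis of clopen sets
and without isolated points. -/
structure IsCantorSpace (X : Type*) [TopologicalSpace X] : Prop where
  nonempty : Nonempty X
  compact : CompactSpace X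
  metrizable : TopologicalSpace.MetrizableSpace X
  clopen_basis : ∃ B : Set (Set X), B.Countable ∧ (∀ b ∈ B, IsClopen b) ∧
    TopologicalSpace.IsTopologicalBasis B
  no_isolated : ∀ x : X, ¬ IsOpen ({x} : Set X)

/-- A pair `Φ = (φL, φU)` of functions `X → [0,1]` with `φL ≤ φU`, `φL` lower semicontinuous
and `φU` upper semicontinuous. -/
structure FencePair (X : Type*) [TopologicalSpace X] where
  lower : X → ℝ
  upper : X → ℝ
  lower_mem : ∀ x, lower x ∈ Set.Icc (0 : ℝ) 1
  upper_mem : ∀ x, upper x ∈ Set.Icc (0 : ℝ) 1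
  lower_le_upper : ∀ x, lower x ≤ upper x
  lower_lsc : LowerSemicontinuous lower
  upper_usc : UpperSemicontinuous upper

namespace FencePair

/-- The fence of `Φ`: the points `(x, t)` with `φL x ≤ t ≤ φU x`. It lies in `X × [0,1]` and
carries the subspace topology. -/
def fence {X : Type*} [TopologicalSpace X] (Φ : FencePair X) : Set (X × ℝ) :=
  {p | Φ.lower p.1 ≤ p.2 ∧ p.2 ≤ Φ.upper p.1}

/-- The fence of `Φ` is a Lelek fence: `φL = 0`, `φU` is positive on a dense set, and the graph
of `φU` (which is contained in the fence) is dense in the fence. -/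
structure IsLelek {X : Type*} [TopologicalSpace X] (Φ : FencePair X) : Prop where
  lower_eq_zero : ∀ x, Φ.lower x = 0
  dense_pos : Dense {x | 0 < Φ.upper x}
  graph_dense : Φ.fence ⊆ closure (Set.range fun x => (x, Φ.upper x))

/-- `T` is a lifting of `h` to the fence of `Φ`: `T (x, t) = (h x, s)` for some `s` in the fibre
over `h x`. -/
def IsLifting {X : Type*} [TopologicalSpace X] (Φ : FencePair X)
    (T : Φ.fence → Φ.fence) (h : X → X) : Prop :=
  ∀ p : Φ.fence, (T p).1.1 = h p.1.1

end FencePair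

/-- Topological mixing. -/
def IsTopMixing {X : Type*} [TopologicalSpace X] (f : X → X) : Prop :=
  ∀ U V : Set X, IsOpen U → IsOpen V → U.Nonempty → V.Nonempty →
    ∃ N : ℕ, ∀ m : ℕ, N ≤ m → ((f^[m] '' U) ∩ V).Nonempty

/-- For all nonempty open `U`, `V` there is a compact nowhere dense set `K` with `f K = K` such
that `f^m (K ∩ U)` meets `V` for all large `m`. -/
def MixesAlongNowhereDense {X : Type*} [TopologicalSpace X] (f : X → X) : Prop :=
  ∀ U V : Set X, IsOpen U → IsOpen V → U.Nonempty → V.Nonempty →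
    ∃ (K : Set X) (N : ℕ), IsCompact K ∧ IsNowhereDense K ∧ f '' K = K ∧
      ∀ m : ℕ, N ≤ m → ((f^[m] '' (K ∩ U)) ∩ V).Nonempty

/-- The two-sided full shift on `n` symbols, `(σ x) i = x (i + 1)`. -/
def fullShift (n : ℕ) : (ℤ → Fin n) ≃ₜ (ℤ → Fin n) where
  toFun x i := x (i + 1)
  invFun x i := x (i - 1)
  left_inv x := by funext i; simp
  right_inv x := by funext i; simp
  continuous_toFun := by fun_prop
  continuous_invFun := by fun_prop

/-! The fence function is `φ = exp (-S)`, where `S`, possibly infinite, is the increasing limit of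
continuous `S k`. The increments change by at most `2⁻ᵏ` from `x` to `h x`, so minus the sum of
these changes is a continuous `a` with `φ ∘ h = exp a * φ`. Hence `(x, t) ↦ (h x, exp (a x) * t)` is
a homeomorphism of the fence that preserves the graph of `φ`.

Mixing is arranged for one pair of basic open sets at a time (`exists_step`). Slow bumps
(`exists_slow_bump`) push the graph into the first set over a small clopen `U` and into the second
over a small clopen `V`. The hypothesis on `h` then supplies an invariant nowhere dense `K` whose
orbits run from `U` to `V`. From then on `S` is frozen on `K`, so these orbits survive in the graph
of `φ`; nowhere density leaves room for later bumps. Density of the graph and of `{φ > 0}` follows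
from the same property.

For the shift, `K` consists of sequences with boundedly many entries different from a fixed symbol.
-/

open Set Filter Topology

/-! ### Functions with small coboundary -/

section Construction

variable {C : Type*} [TopologicalSpace C]

/-- Given a height `s` and a bound `ε`, there is a time `M` such that every clopen set `U` carries
a continuous function equal to `s` on `U`, whose variation along orbits of `h` is at most `ε`, and
which vanishes at the points that do not meet `U` within time `M`. -/
theorem exists_slow_bump (h : C ≃ₜ C) {s ε : ℝ} (hs : 0 ≤ s) (hε : 0 < ε) :
    ∃ M : ℕ, ∀ U : Set C, IsClopen U → ∃ ψ : C → ℝ, Continuous ψ ∧ (∀ x, 0 ≤ ψ x) ∧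
      (∀ x, |ψ (h x) - ψ x| ≤ ε) ∧ (∀ x ∈ U, ψ x = s) ∧
      ∀ x, (∀ i : ℤ, |i| ≤ M → (h ^ i) x ∉ U) → ψ x = 0 := by
  obtain ⟨M, hM⟩ := exists_nat_gt (s / ε)
  have hM' : s < ε * M := by rwa [div_lt_iff₀' hε] at hM
  refine ⟨M, fun U hU => ?_⟩
  -- A tent of slope `ε` in orbit time; `M > s / ε` makes it vanish before the window `|i| ≤ M`
  -- ends.
  set c : ℤ → ℝ := fun i => max (s - ε * |(i : ℝ)|) 0 with hc
  have c0 : ∀ i, 0 ≤ c i := fun i => le_max_right _ _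
  have cs : ∀ i, c i ≤ s := fun i =>
    max_le (by have := mul_nonneg hε.le (abs_nonneg (i : ℝ)); linarith) hs
  have cstep : ∀ i j : ℤ, |i - j| ≤ 1 → c i ≤ c j + ε := by
    intro i j hij
    have h1 : |(i : ℝ) - j| ≤ 1 := by exact_mod_cast hij
    have h2 : |(j : ℝ)| ≤ |(i : ℝ)| + 1 := by
      have := abs_sub_abs_le_abs_sub (j : ℝ) i
      rw [abs_sub_comm] at this
      linarith
    refine max_le ?_ (add_nonneg (c0 j) hε.le)
    have h3 : s - ε * |(j : ℝ)| ≤ c j := le_max_left _ _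
    have h4 := mul_le_mul_of_nonneg_left h2 hε.le
    linarith
  have cbig : ∀ i : ℤ, (M : ℤ) ≤ |i| → c i = 0 := by
    intro i hi
    have h1 : (M : ℝ) ≤ |(i : ℝ)| := by exact_mod_cast hi
    have h2 := mul_le_mul_of_nonneg_left h1 hε.le
    exact max_eq_right (by linarith)
  set I : Finset ℤ := Finset.Icc (-(M : ℤ)) M with hI
  have memI : ∀ i : ℤ, i ∈ I ↔ |i| ≤ M := fun i => by rw [hI, Finset.mem_Icc, abs_le]
  have h0I : (0 : ℤ) ∈ I := (memI 0).2 (by simp)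
  have hIne : I.Nonempty := ⟨0, h0I⟩
  set f : ℤ → C → ℝ := fun i x => U.indicator (fun _ => c i) ((h ^ i) x) with hf
  have f0 : ∀ i x, 0 ≤ f i x := fun i x => indicator_nonneg (fun _ _ => c0 i) _
  have fc : ∀ i x, f i x ≤ c i := fun i x => indicator_le_self' (fun _ _ => c0 i) _
  -- With a maximum, overlapping translates of `U` do no harm: height and slope bounds persist.
  set ψ : C → ℝ := fun x => I.sup' hIne fun i => f i x with hψ
  have ψ0 : ∀ x, 0 ≤ ψ x := fun x => (f0 0 x).trans (Finset.le_sup' (fun i => f i x) h0I)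
  have key : ∀ x y : C, ∀ d : ℤ, |d| ≤ 1 → (∀ i : ℤ, (h ^ i) y = (h ^ (i + d)) x) →
      ψ y ≤ ψ x + ε := by
    intro x y d hd hxy
    refine Finset.sup'_le _ _ fun i hi => ?_
    by_cases hi' : i + d ∈ I
    · have h1 : f (i + d) x ≤ ψ x := Finset.le_sup' (fun i => f i x) hi'
      have h2 : f i y ≤ f (i + d) x + ε := by
        simp only [hf, hxy]
        by_cases hm : (h ^ (i + d)) x ∈ U
        · rw [indicator_of_mem hm, indicator_of_mem hm]
          exact cstep _ _ (by simpa using hd)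
        · rw [indicator_of_notMem hm, indicator_of_notMem hm]
          linarith
      linarith
    -- An index shifted out of the window was at its edge, where the tent is already zero.
    · have h3 : (M : ℤ) ≤ |i| := by
        rw [memI] at hi'
        have := abs_add_le i d
        omega
      have h1 := fc i y
      rw [cbig i h3] at h1
      have := ψ0 x
      linarith
  refine ⟨ψ, ?_, ψ0, fun x => ?_, fun x hx => ?_, fun x hx => ?_⟩
  · refine Continuous.finset_sup'_apply hIne fun i _ => ?_
    exact (continuous_const.indicator fun a ha => by simp [hU.frontier_eq] at ha).comp
      (h ^ i).continuous
  · have h1 := key x (h x) 1 (by simp) fun i => by rw [zpow_add_one]; rfl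
    have h2 := key (h x) x (-1) (by simp) fun i => by
      have : (h ^ i) = h ^ (i + -1) * h := by rw [← zpow_add_one]; simp
      rw [this]; rfl
    rw [abs_le]
    constructor <;> linarith
  · refine le_antisymm (Finset.sup'_le _ _ fun i _ => (fc i x).trans (cs i)) ?_
    have h1 : f 0 x ≤ ψ x := Finset.le_sup' (fun i => f i x) h0I
    have h2 : f 0 x = s := by
      have : (h ^ (0 : ℤ)) x ∈ U := by simpa using hx
      simp only [hf]
      rw [indicator_of_mem this]
      simp [hc, hs]
    linarith
  · refine le_antisymm (Finset.sup'_le _ _ fun i hi => ?_) (ψ0 x)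
    simp only [hf]
    rw [indicator_of_notMem (hx i ((memI i).1 hi))]

theorem IsCantorSpace.exists_isClopen_subset (hC : IsCantorSpace C) {x : C} {U : Set C}
    (hU : IsOpen U) (hx : x ∈ U) : ∃ V, IsClopen V ∧ x ∈ V ∧ V ⊆ U := by
  obtain ⟨B, -, hB, hbasis⟩ := hC.clopen_basis
  obtain ⟨V, hV, hxV, hVU⟩ := hbasis.exists_subset_of_mem_open hx hU
  exact ⟨V, hB V hV, hxV, hVU⟩

theorem IsCantorSpace.exists_mem_notMem_finite (hC : IsCantorSpace C) {U P : Set C}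
    (hU : IsOpen U) (hne : U.Nonempty) (hP : P.Finite) : ∃ x ∈ U, x ∉ P := by
  have := hC.metrizable
  obtain ⟨x, hx⟩ := hne
  have hx' : (𝓝[≠] x).NeBot := by
    rw [neBot_iff]
    exact fun hbot => hC.no_isolated x ((isOpen_singleton_iff_punctured_nhds x).2 hbot)
  exact ((infinite_of_mem_nhds x (hU.mem_nhds hx)).sdiff hP).nonempty

/-- A closed set with dense complement that is completely invariant under `h`. -/
structure IsThinInvariant (h : C ≃ₜ C) (L : Set C) : Prop where
  isClosed : IsClosed L
  dense_compl : Dense Lᶜ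
  apply_mem_iff : ∀ x, h x ∈ L ↔ x ∈ L

namespace IsThinInvariant

variable {h : C ≃ₜ C} {L K : Set C}

theorem empty (h : C ≃ₜ C) : IsThinInvariant h ∅ := ⟨isClosed_empty, by simp, by simp⟩

theorem union (hL : IsThinInvariant h L) (hK : IsThinInvariant h K) :
    IsThinInvariant h (L ∪ K) where
  isClosed := hL.isClosed.union hK.isClosed
  dense_compl := by
    rw [compl_union]
    exact hL.dense_compl.inter_of_isOpen_left hK.dense_compl hL.isClosed.isOpen_compl
  apply_mem_iff x := by simp [hL.apply_mem_iff, hK.apply_mem_iff]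

theorem zpow_apply_mem_iff (hL : IsThinInvariant h L) (i : ℤ) (x : C) :
    (h ^ i) x ∈ L ↔ x ∈ L := by
  induction i generalizing x with
  | zero => simp
  | succ n ih =>
    rw [zpow_add_one, show (h ^ (n : ℤ) * h) x = (h ^ (n : ℤ)) (h x) from rfl, ih,
      hL.apply_mem_iff]
  | pred n ih =>
    rw [zpow_sub_one, show (h ^ (-(n : ℤ)) * h⁻¹) x = (h ^ (-(n : ℤ))) (h.symm x) from rfl, ih,
      ← hL.apply_mem_iff, h.apply_symm_apply]

theorem iterate_mem (hL : IsThinInvariant h L) {x : C} (hx : x ∈ L) (m : ℕ) : h^[m] x ∈ L := by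
  induction m with
  | zero => exact hx
  | succ m ih => rw [Function.iterate_succ_apply', hL.apply_mem_iff]; exact ih

end IsThinInvariant

theorem isThinInvariant_of_image_eq [T2Space C] {h : C ≃ₜ C} {K : Set C} (hK : IsCompact K)
    (hnd : IsNowhereDense K) (him : h '' K = K) : IsThinInvariant h K where
  isClosed := hK.isClosed
  dense_compl := by
    rw [← interior_eq_empty_iff_dense_compl, ← hK.isClosed.closure_eq]
    exact hnd
  apply_mem_iff x := by
    conv_lhs => rw [← him]
    exact h.injective.mem_set_image

/-- One step of the construction: a function with small coboundary is added to `S` and an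
invariant thin set is added to `L` in such a way that, if the open sets `W` and `W'` both meet the
region below the graph of `exp (-S)`, then orbits in the new thin set run from `W` to `W'` on the
graph of the new function, for all large times. -/
theorem exists_step (hC : IsCantorSpace C) (h : C ≃ₜ C) (hmix : MixesAlongNowhereDense h)
    {S : C → ℝ} (hS : Continuous S) {L : Set C} (hL : IsThinInvariant h L)
    {W W' : Set (C × ℝ)} (hW : IsOpen W) (hW' : IsOpen W') {ε : ℝ} (hε : 0 < ε) :
    ∃ (S' : C → ℝ) (L' : Set C), Continuous S' ∧ IsThinInvariant h L' ∧ L ⊆ L' ∧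
      (∀ x, S x ≤ S' x) ∧ (∀ x ∈ L, S' x = S x) ∧
      (∀ x, |(S' (h x) - S (h x)) - (S' x - S x)| ≤ ε) ∧
      ((∃ x s, S x ≤ s ∧ (x, Real.exp (-s)) ∈ W) →
        (∃ x s, S x ≤ s ∧ (x, Real.exp (-s)) ∈ W') →
        ∃ N : ℕ, ∀ m ≥ N, ∃ z ∈ L', (z, Real.exp (-S' z)) ∈ W ∧
          (h^[m] z, Real.exp (-S' (h^[m] z))) ∈ W') := by
  have := hC.metrizable
  by_cases hcond : (∃ x s, S x ≤ s ∧ (x, Real.exp (-s)) ∈ W) ∧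
      ∃ x s, S x ≤ s ∧ (x, Real.exp (-s)) ∈ W'
  swap
  · exact ⟨S, L, hS, hL, Subset.rfl, fun _ => le_rfl, fun _ _ => rfl, fun x => by simp [hε.le],
      fun h1 h2 => absurd ⟨h1, h2⟩ hcond⟩
  obtain ⟨⟨x₀, s₀, hs₀, hx₀⟩, y₀, t₀, ht₀, hy₀⟩ := hcond
  obtain ⟨s, hs, rfl⟩ : ∃ s, 0 ≤ s ∧ s₀ = S x₀ + s := ⟨s₀ - S x₀, by linarith, by ring⟩
  obtain ⟨t, ht, rfl⟩ : ∃ t, 0 ≤ t ∧ t₀ = S y₀ + t := ⟨t₀ - S y₀, by linarith, by ring⟩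
  set U₀ : Set C := {z | (z, Real.exp (-(S z + s))) ∈ W} with hU₀
  set V₀ : Set C := {z | (z, Real.exp (-(S z + t))) ∈ W'} with hV₀
  have oU₀ : IsOpen U₀ := hW.preimage (by fun_prop)
  have oV₀ : IsOpen V₀ := hW'.preimage (by fun_prop)
  obtain ⟨M₁, hM₁⟩ := exists_slow_bump h hs (half_pos hε)
  obtain ⟨M₂, hM₂⟩ := exists_slow_bump h ht (half_pos hε)
  set I : Set ℤ := {i | |i| ≤ max M₁ M₂} with hI
  have hIfin : I.Finite := (Set.finite_Icc (-((max M₁ M₂ : ℕ) : ℤ)) (max M₁ M₂ : ℕ)).subset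
    fun i hi => abs_le.1 hi
  obtain ⟨x, hxL, hxU⟩ := hL.dense_compl.exists_mem_open oU₀ ⟨x₀, hx₀⟩
  obtain ⟨y', hy'L, hy'V⟩ := hL.dense_compl.exists_mem_open oV₀ ⟨y₀, hy₀⟩
  -- `y` avoids a finite orbit segment of `x`, so `U` and `V` can be shrunk until neither bump
  -- reaches the other's base.
  have hPfin : ((fun i : ℤ => (h ^ i) x) '' I).Finite := hIfin.image _
  obtain ⟨y, ⟨hyV, hyL⟩, hyP⟩ := hC.exists_mem_notMem_finite
    (oV₀.inter hL.isClosed.isOpen_compl) ⟨y', hy'V, hy'L⟩ hPfin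
  obtain ⟨V, cV, hyV', hV⟩ := hC.exists_isClopen_subset
    ((oV₀.inter hL.isClosed.isOpen_compl).inter hPfin.isClosed.isOpen_compl) ⟨⟨hyV, hyL⟩, hyP⟩
  have oI : IsOpen (⋂ i ∈ I, (h ^ i) ⁻¹' Vᶜ) :=
    hIfin.isOpen_biInter fun i _ => cV.compl.isOpen.preimage (h ^ i).continuous
  obtain ⟨U, cU, hxU', hU⟩ := hC.exists_isClopen_subset
    ((oU₀.inter hL.isClosed.isOpen_compl).inter oI)
    ⟨⟨hxU, hxL⟩, mem_iInter₂.2 fun i hi hm => (hV hm).2 ⟨i, hi, rfl⟩⟩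
  have hUV : ∀ z ∈ U, ∀ i : ℤ, |i| ≤ max M₁ M₂ → (h ^ i) z ∉ V := fun z hz i hi =>
    mem_iInter₂.1 (hU hz).2 i hi
  have hVU : ∀ z ∈ V, ∀ i : ℤ, |i| ≤ max M₁ M₂ → (h ^ i) z ∉ U := fun z hz i hi hzU => by
    refine hUV _ hzU (-i) (by rwa [abs_neg]) ?_
    rwa [show (h ^ (-i)) ((h ^ i) z) = (h ^ (-i) * h ^ i) z from rfl, ← zpow_add,
      neg_add_cancel, zpow_zero]
  obtain ⟨ψ, cψ, ψ0, ψh, ψU, ψz⟩ := hM₁ U cU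
  obtain ⟨θ, cθ, θ0, θh, θV, θz⟩ := hM₂ V cV
  -- `U` misses the invariant set `L`, so orbits in `L` never enter `U`; likewise for `V`.
  have ψL : ∀ z ∈ L, ψ z = 0 := fun z hz => ψz z fun i _ hi =>
    (hU hi).1.2 ((hL.zpow_apply_mem_iff i z).2 hz)
  have θL : ∀ z ∈ L, θ z = 0 := fun z hz => θz z fun i _ hi =>
    (hV hi).1.2 ((hL.zpow_apply_mem_iff i z).2 hz)
  have ψV : ∀ z ∈ V, ψ z = 0 := fun z hz => ψz z fun i hi =>
    hVU z hz i (hi.trans (by exact_mod_cast le_max_left _ _))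
  have θU : ∀ z ∈ U, θ z = 0 := fun z hz => θz z fun i hi =>
    hUV z hz i (hi.trans (by exact_mod_cast le_max_right _ _))
  obtain ⟨K, N, hK, hKnd, hKh, hKN⟩ := hmix U V cU.isOpen cV.isOpen ⟨x, hxU'⟩ ⟨y, hyV'⟩
  refine ⟨fun z => S z + (ψ z + θ z), L ∪ K, by fun_prop,
    hL.union (isThinInvariant_of_image_eq hK hKnd hKh), subset_union_left,
    fun z => by have := ψ0 z; have := θ0 z; linarith, fun z hz => by simp [ψL z hz, θL z hz],
    fun z => ?_, fun _ _ => ⟨N, fun m hm => ?_⟩⟩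
  · have h1 := abs_le.1 (ψh z)
    have h2 := abs_le.1 (θh z)
    rw [abs_le]
    constructor <;> linarith [h1.1, h1.2, h2.1, h2.2]
  · obtain ⟨_, ⟨z, ⟨hzK, hzU⟩, rfl⟩, hzV⟩ := hKN m hm
    refine ⟨z, Or.inr hzK, ?_, ?_⟩
    · have : z ∈ U₀ := (hU hzU).1.1
      simpa only [ψU z hzU, θU z hzU, add_zero, hU₀, mem_ofPred_eq] using this
    · have : h^[m] z ∈ V₀ := (hV hzV).1.1
      simpa only [ψV _ hzV, θV _ hzV, zero_add, hV₀, mem_ofPred_eq] using this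

end Construction

/-! ### The fence and the lifting -/

section Lifting

variable {C : Type*} [TopologicalSpace C]

/-- The sequence of functions `S k` and thin sets `L k` obtained by iterating `exists_step`, where
the `k`-th step treats the pair of open sets `W k`, `W' k`. -/
theorem exists_step_sequence (hC : IsCantorSpace C) (h : C ≃ₜ C) (hmix : MixesAlongNowhereDense h)
    (W W' : ℕ → Set (C × ℝ)) (hW : ∀ k, IsOpen (W k)) (hW' : ∀ k, IsOpen (W' k)) :
    ∃ (S : ℕ → C → ℝ) (L : ℕ → Set C), (∀ x, S 0 x = 0) ∧ (∀ k, Continuous (S k)) ∧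
      (∀ k, IsThinInvariant h (L k)) ∧ Monotone L ∧ (∀ x, Monotone fun k => S k x) ∧
      (∀ k, ∀ x ∈ L k, S (k + 1) x = S k x) ∧
      (∀ k x, |(S (k + 1) (h x) - S k (h x)) - (S (k + 1) x - S k x)| ≤ (1 / 2 : ℝ) ^ k) ∧
      ∀ k, (∃ x s, S k x ≤ s ∧ (x, Real.exp (-s)) ∈ W k) →
        (∃ x s, S k x ≤ s ∧ (x, Real.exp (-s)) ∈ W' k) →
        ∃ N : ℕ, ∀ m ≥ N, ∃ z ∈ L (k + 1), (z, Real.exp (-S (k + 1) z)) ∈ W k ∧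
          (h^[m] z, Real.exp (-S (k + 1) (h^[m] z))) ∈ W' k := by
  let Stage := {p : (C → ℝ) × Set C // Continuous p.1 ∧ IsThinInvariant h p.2}
  have step : ∀ (k : ℕ) (p : Stage), ∃ q : Stage, p.1.2 ⊆ q.1.2 ∧ (∀ x, p.1.1 x ≤ q.1.1 x) ∧
      (∀ x ∈ p.1.2, q.1.1 x = p.1.1 x) ∧
      (∀ x, |(q.1.1 (h x) - p.1.1 (h x)) - (q.1.1 x - p.1.1 x)| ≤ (1 / 2 : ℝ) ^ k) ∧
      ((∃ x s, p.1.1 x ≤ s ∧ (x, Real.exp (-s)) ∈ W k) →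
        (∃ x s, p.1.1 x ≤ s ∧ (x, Real.exp (-s)) ∈ W' k) →
        ∃ N : ℕ, ∀ m ≥ N, ∃ z ∈ q.1.2, (z, Real.exp (-q.1.1 z)) ∈ W k ∧
          (h^[m] z, Real.exp (-q.1.1 (h^[m] z))) ∈ W' k) := by
    rintro k ⟨⟨S, L⟩, hS, hL⟩
    obtain ⟨S', L', hS', hL', hrest⟩ := exists_step hC h hmix hS hL (hW k) (hW' k)
      (ε := (1 / 2 : ℝ) ^ k) (by positivity)
    exact ⟨⟨(S', L'), hS', hL'⟩, hrest⟩
  choose next hsub hle heq hcob hrun using step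
  let stage : ℕ → Stage := fun k =>
    Nat.rec ⟨(fun _ => 0, ∅), continuous_const, IsThinInvariant.empty h⟩ next k
  exact ⟨fun k => (stage k).1.1, fun k => (stage k).1.2, fun _ => rfl, fun k => (stage k).2.1,
    fun k => (stage k).2.2, monotone_nat_of_le_succ fun k => hsub k (stage k),
    fun x => monotone_nat_of_le_succ fun k => hle k (stage k) x, fun k => heq k (stage k),
    fun k => hcob k (stage k), fun k => hrun k (stage k)⟩

/-- A fence function `φ` on which `h` acts by a positive continuous cocycle, and whose graph
carries the mixing behaviour of `h`. -/
theorem exists_fence_function (hC : IsCantorSpace C) (h : C ≃ₜ C)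
    (hmix : MixesAlongNowhereDense h) :
    ∃ φ a : C → ℝ, (∀ x, φ x ∈ Icc (0 : ℝ) 1) ∧ UpperSemicontinuous φ ∧ Continuous a ∧
      (∀ x, φ (h x) = Real.exp (a x) * φ x) ∧
      ∀ O O' : Set (C × ℝ), IsOpen O → IsOpen O' →
        (∃ x u, 0 ≤ u ∧ u ≤ φ x ∧ (x, u) ∈ O) → (∃ x u, 0 ≤ u ∧ u ≤ φ x ∧ (x, u) ∈ O') →
        ∃ N : ℕ, ∀ m ≥ N, ∃ z, 0 < φ z ∧ (z, φ z) ∈ O ∧ (h^[m] z, φ (h^[m] z)) ∈ O' := by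
  have := hC.metrizable
  have := hC.compact
  have : SecondCountableTopology C := by
    let _ := TopologicalSpace.metrizableSpaceMetric C
    infer_instance
  let B := TopologicalSpace.countableBasis (C × ℝ)
  have hB := TopologicalSpace.isBasis_countableBasis (C × ℝ)
  have : Countable B := (TopologicalSpace.countable_countableBasis (C × ℝ)).to_subtype
  have : Nonempty B := by
    obtain ⟨x⟩ := hC.nonempty
    obtain ⟨b, hb, -⟩ := hB.exists_subset_of_mem_open (mem_univ (x, (0 : ℝ))) isOpen_univ
    exact ⟨⟨b, hb⟩⟩
  obtain ⟨e, he⟩ := exists_surjective_nat (B × B)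
  obtain ⟨S, L, S0, cS, hL, mL, mS, hSL, hcob, hrun⟩ := exists_step_sequence hC h hmix
    (fun k => (e k).1.1) (fun k => (e k).2.1) (fun k => hB.isOpen (e k).1.2)
    (fun k => hB.isOpen (e k).2.2)
  set φ : C → ℝ := fun x => ⨅ k, Real.exp (-S k x) with hφ
  have bdd : ∀ x, BddBelow (range fun k => Real.exp (-S k x)) := fun x =>
    ⟨0, by rintro _ ⟨k, rfl⟩; positivity⟩
  have φle : ∀ k x, φ x ≤ Real.exp (-S k x) := fun k x => ciInf_le (bdd x) k
  have φ0 : ∀ x, 0 ≤ φ x := fun x => le_ciInf fun k => by positivity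
  have φlim : ∀ x, Tendsto (fun k => Real.exp (-S k x)) atTop (𝓝 (φ x)) := fun x =>
    tendsto_atTop_ciInf (fun i j hij => Real.exp_le_exp.2 (neg_le_neg (mS x hij))) (bdd x)
  -- Freezing: on `L k` the sequence is constant from stage `k` on, so `φ` is attained there and
  -- positive.
  have Sconst : ∀ k j, k ≤ j → ∀ x ∈ L k, S j x = S k x := by
    intro k j hkj x hx
    induction j, hkj using Nat.le_induction with
    | base => rfl
    | succ j hkj ih => rw [hSL j x (mL hkj hx), ih]
  have φL : ∀ k, ∀ x ∈ L k, φ x = Real.exp (-S k x) := fun k x hx =>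
    tendsto_nhds_unique (φlim x) (tendsto_const_nhds.congr' (by
      filter_upwards [eventually_ge_atTop k] with j hj
      rw [Sconst k j hj x hx]))
  set d : ℕ → C → ℝ := fun k x => (S (k + 1) (h x) - S k (h x)) - (S (k + 1) x - S k x) with hd
  have dsum : ∀ x n, ∑ k ∈ Finset.range n, d k x = S n (h x) - S n x := by
    intro x n
    induction n with
    | zero => simp [S0]
    | succ n ih => rw [Finset.sum_range_succ, ih]; simp only [hd]; ring
  have dbound : ∀ k x, ‖d k x‖ ≤ (1 / 2 : ℝ) ^ k := hcob
  have hgeom : Summable fun k : ℕ => (1 / 2 : ℝ) ^ k := summable_geometric_two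
  refine ⟨φ, fun x => -∑' k, d k x, fun x => ⟨φ0 x, ?_⟩, ?_, ?_, fun x => ?_, ?_⟩
  · simpa [S0] using φle 0 x
  · refine upperSemicontinuous_ciInf bdd fun k => Continuous.upperSemicontinuous ?_
    have := cS k
    fun_prop
  · refine (continuous_tsum (fun k => ?_) hgeom dbound).neg
    have := cS k
    have := cS (k + 1)
    have := h.continuous
    fun_prop
  · have hsum : Summable fun k => d k x := hgeom.of_norm_bounded fun k => dbound k x
    have h1 := hsum.hasSum.tendsto_sum_nat
    -- The cocycle identity is exact at each finite stage; passing to the limit after exponentiating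
    -- also covers points with `φ x = 0`.
    have h2 : Tendsto (fun n => Real.exp (-∑ k ∈ Finset.range n, d k x) * Real.exp (-S n x)) atTop
        (𝓝 (Real.exp (-∑' k, d k x) * φ x)) :=
      ((Real.continuous_exp.tendsto _).comp h1.neg).mul (φlim x)
    refine tendsto_nhds_unique (φlim (h x)) (h2.congr fun n => ?_)
    rw [← Real.exp_add, dsum]
    congr 1
    ring
  -- Height `u = 0` is not of the form `exp (-s)`, so `u` is first moved slightly towards `exp (-S k
  -- x) > 0`.
  · have below : ∀ k x u (b : Set (C × ℝ)), IsOpen b → 0 ≤ u → u ≤ φ x → (x, u) ∈ b →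
        ∃ y s, S k y ≤ s ∧ (y, Real.exp (-s)) ∈ b := by
      intro k x u b ob hu hux hb
      set w := Real.exp (-S k x) with hw
      have hw0 : 0 < w := Real.exp_pos _
      have huw : u ≤ w := hux.trans (φle k x)
      have hc : Tendsto (fun δ : ℝ => (x, (1 - δ) * u + δ * w)) (𝓝[>] 0) (𝓝 (x, u)) := by
        have : Continuous fun δ : ℝ => (x, (1 - δ) * u + δ * w) := by fun_prop
        simpa using (this.tendsto 0).mono_left nhdsWithin_le_nhds
      obtain ⟨δ, hδb, hδ⟩ := ((hc.eventually (ob.mem_nhds hb)).and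
        (Ioo_mem_nhdsGT (zero_lt_one' ℝ))).exists
      set v := (1 - δ) * u + δ * w with hv
      have hv0 : 0 < v := by
        have := mul_nonneg (sub_nonneg.2 hδ.2.le) hu
        have := mul_pos hδ.1 hw0
        linarith
      have hvw : v ≤ w := by
        have := mul_le_mul_of_nonneg_left huw (sub_nonneg.2 hδ.2.le)
        linarith
      refine ⟨x, -Real.log v, ?_, by rwa [neg_neg, Real.exp_log hv0]⟩
      have := Real.log_le_log hv0 hvw
      rw [hw, Real.log_exp] at this
      linarith
    rintro O O' hO hO' ⟨x, u, hu, hux, hxO⟩ ⟨y, v, hv, hvy, hyO⟩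
    obtain ⟨b, hb, hxb, hbO⟩ := hB.exists_subset_of_mem_open hxO hO
    obtain ⟨b', hb', hyb, hbO'⟩ := hB.exists_subset_of_mem_open hyO hO'
    obtain ⟨k, hk⟩ := he (⟨b, hb⟩, ⟨b', hb'⟩)
    have hk1 : (e k).1.1 = b := by rw [hk]
    have hk2 : (e k).2.1 = b' := by rw [hk]
    obtain ⟨N, hN⟩ := hrun k (by rw [hk1]; exact below k x u b (hB.isOpen hb) hu hux hxb)
      (by rw [hk2]; exact below k y v b' (hB.isOpen hb') hv hvy hyb)
    refine ⟨N, fun m hm => ?_⟩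
    obtain ⟨z, hzL, hz1, hz2⟩ := hN m hm
    rw [hk1] at hz1
    rw [hk2] at hz2
    refine ⟨z, ?_, ?_, ?_⟩
    · rw [φL _ z hzL]
      positivity
    · rw [φL _ z hzL]
      exact hbO hz1
    · rw [φL _ _ ((hL (k + 1)).iterate_mem hzL m)]
      exact hbO' hz2

/-- The fence pair with lower function `0`. -/
def FencePair.ofUpper (φ : C → ℝ) (hφ : ∀ x, φ x ∈ Icc (0 : ℝ) 1) (husc : UpperSemicontinuous φ) :
    FencePair C where
  lower _ := 0
  upper := φ
  lower_mem _ := by simp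
  upper_mem := hφ
  lower_le_upper x := (hφ x).1
  lower_lsc := lowerSemicontinuous_const
  upper_usc := husc

/-- The map `(x, t) ↦ (h x, exp (a x) * t)` on the fence under a function `φ` with
`φ (h x) = exp (a x) * φ x`. -/
noncomputable def fenceHomeomorph (h : C ≃ₜ C) {φ a : C → ℝ} (hφ : ∀ x, φ x ∈ Icc (0 : ℝ) 1)
    (husc : UpperSemicontinuous φ) (ha : Continuous a)
    (hcoc : ∀ x, φ (h x) = Real.exp (a x) * φ x) :
    (FencePair.ofUpper φ hφ husc).fence ≃ₜ (FencePair.ofUpper φ hφ husc).fence where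
  toFun p := ⟨(h p.1.1, Real.exp (a p.1.1) * p.1.2), mul_nonneg (Real.exp_nonneg _) p.2.1, by
    change Real.exp (a p.1.1) * p.1.2 ≤ φ (h p.1.1)
    rw [hcoc]
    exact mul_le_mul_of_nonneg_left p.2.2 (Real.exp_nonneg _)⟩
  invFun p := ⟨(h.symm p.1.1, Real.exp (-a (h.symm p.1.1)) * p.1.2),
    mul_nonneg (Real.exp_nonneg _) p.2.1, by
    change Real.exp (-a (h.symm p.1.1)) * p.1.2 ≤ φ (h.symm p.1.1)
    have h1 : p.1.2 ≤ φ p.1.1 := p.2.2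
    rw [← h.apply_symm_apply p.1.1, hcoc] at h1
    have h2 := mul_le_mul_of_nonneg_left h1 (Real.exp_nonneg (-a (h.symm p.1.1)))
    rwa [← mul_assoc, ← Real.exp_add, neg_add_cancel, Real.exp_zero, one_mul] at h2⟩
  left_inv p := by
    ext
    · simp
    · simp [← mul_assoc, ← Real.exp_add]
  right_inv p := by
    ext
    · simp
    · simp [← mul_assoc, ← Real.exp_add]
  continuous_toFun := by
    have := h.continuous
    fun_prop
  continuous_invFun := by
    have := h.symm.continuous
    fun_prop

theorem exists_lelek_mixing_lifting (hC : IsCantorSpace C) (h : C ≃ₜ C)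
    (hmix : MixesAlongNowhereDense h) :
    ∃ Φ : FencePair C, Φ.IsLelek ∧
      ∃ T : Φ.fence ≃ₜ Φ.fence, Φ.IsLifting T h ∧ IsTopMixing T := by
  obtain ⟨φ, a, hφ, husc, ha, hcoc, hrun⟩ := exists_fence_function hC h hmix
  refine ⟨FencePair.ofUpper φ hφ husc, ⟨fun _ => rfl, ?_, ?_⟩,
    fenceHomeomorph h hφ husc ha hcoc, fun _ => rfl, ?_⟩
  · rw [dense_iff_inter_open]
    rintro U hU ⟨x, hx⟩
    have hx' : ∃ x u, 0 ≤ u ∧ u ≤ φ x ∧ (x, u) ∈ Prod.fst ⁻¹' U := ⟨x, 0, le_rfl, (hφ x).1, hx⟩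
    obtain ⟨N, hN⟩ := hrun _ _ (hU.preimage continuous_fst) (hU.preimage continuous_fst) hx' hx'
    obtain ⟨z, hz0, hz, -⟩ := hN N le_rfl
    exact ⟨z, hz, hz0⟩
  · rintro ⟨x, u⟩ hxu
    rw [mem_closure_iff]
    intro O hO hxO
    have hx' : ∃ x u, 0 ≤ u ∧ u ≤ φ x ∧ (x, u) ∈ O := ⟨x, u, hxu.1, hxu.2, hxO⟩
    obtain ⟨N, hN⟩ := hrun _ _ hO hO hx' hx'
    obtain ⟨z, -, hz, -⟩ := hN N le_rfl
    exact ⟨_, hz, z, rfl⟩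
  · set T := fenceHomeomorph h hφ husc ha hcoc with hT
    -- Graph points stay on the graph, so their orbits under `T` are determined by those of `h`.
    have graph : ∀ (m : ℕ) (p : (FencePair.ofUpper φ hφ husc).fence), p.1.2 = φ p.1.1 →
        (T^[m] p).1 = (h^[m] p.1.1, φ (h^[m] p.1.1)) := by
      intro m p hp
      induction m with
      | zero => exact Prod.ext rfl hp
      | succ m ih =>
        rw [Function.iterate_succ_apply', Function.iterate_succ_apply', hcoc]
        change (h (T^[m] p).1.1, Real.exp (a (T^[m] p).1.1) * (T^[m] p).1.2) = _
        rw [ih]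
    rintro _ _ ⟨O, hO, rfl⟩ ⟨O', hO', rfl⟩ ⟨p, hp⟩ ⟨q, hq⟩
    obtain ⟨N, hN⟩ := hrun O O' hO hO' ⟨p.1.1, p.1.2, p.2.1, p.2.2, hp⟩
      ⟨q.1.1, q.1.2, q.2.1, q.2.2, hq⟩
    refine ⟨N, fun m hm => ?_⟩
    obtain ⟨z, -, hz, hz'⟩ := hN m hm
    refine ⟨_, ⟨⟨(z, φ z), (hφ z).1, le_rfl⟩, hz, rfl⟩, ?_⟩
    rw [mem_preimage, graph m _ rfl]
    exact hz'

end Lifting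

/-! ### The full shift -/

section Shift

theorem exists_finset_agree_subset {n : ℕ} {U : Set (ℤ → Fin n)} (hU : IsOpen U) {x : ℤ → Fin n}
    (hx : x ∈ U) : ∃ I : Finset ℤ, ∀ y : ℤ → Fin n, (∀ i ∈ I, y i = x i) → y ∈ U := by
  obtain ⟨I, u, hu, hsub⟩ := isOpen_pi_iff.1 hU x hx
  refine ⟨I, fun y hy => hsub fun i hi => ?_⟩
  rw [hy i hi]
  exact (hu i hi).2

theorem isCantorSpace_int_fin {n : ℕ} (hn : 2 ≤ n) : IsCantorSpace (ℤ → Fin n) where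
  nonempty := ⟨fun _ => ⟨0, by omega⟩⟩
  compact := inferInstance
  metrizable := inferInstance
  clopen_basis := by
    refine ⟨{s | IsClopen s}, ?_, fun b hb => hb, isTopologicalBasis_isClopen⟩
    have : Countable (TopologicalSpace.Clopens (ℤ → Fin n)) :=
      TopologicalSpace.Clopens.countable_iff_secondCountable.2 inferInstance
    refine (countable_range fun s : TopologicalSpace.Clopens (ℤ → Fin n) => (s : Set _)).mono ?_
    exact fun s hs => ⟨⟨s, hs⟩, rfl⟩
  no_isolated x hx := by
    obtain ⟨I, hI⟩ := exists_finset_agree_subset hx (mem_singleton x)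
    obtain ⟨i, hi⟩ := Infinite.exists_notMem_finset I
    have : Nontrivial (Fin n) := Fin.nontrivial_iff_two_le.2 hn
    obtain ⟨c, hc⟩ := exists_ne (x i)
    have h1 := hI (Function.update x i c) fun j hj =>
      Function.update_of_ne (by rintro rfl; exact hi hj) _ _
    have h2 := congrFun (mem_singleton_iff.1 h1) i
    exact hc (by simpa using h2)

theorem fullShift_iterate_apply {n : ℕ} (m : ℕ) (x : ℤ → Fin n) (i : ℤ) :
    (fullShift n)^[m] x i = x (i + m) := by
  induction m generalizing i with
  | zero => simp
  | succ m ih =>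
    rw [Function.iterate_succ_apply']
    change (fullShift n)^[m] x (i + 1) = _
    rw [ih]
    congr 1
    push_cast
    ring

theorem IsTopMixing.of_mixesAlongNowhereDense {X : Type*} [TopologicalSpace X] {f : X → X}
    (hf : MixesAlongNowhereDense f) : IsTopMixing f := fun U V hU hV hU' hV' => by
  obtain ⟨K, N, -, -, -, hN⟩ := hf U V hU hV hU' hV'
  exact ⟨N, fun m hm => (hN m hm).mono
    (inter_subset_inter_left _ (image_mono inter_subset_right))⟩

/-- The sequences with at most `M` entries different from `c`. -/
def sparseSequences {n : ℕ} (c : Fin n) (M : ℕ) : Set (ℤ → Fin n) :=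
  {x | ∀ J : Finset ℤ, (∀ i ∈ J, x i ≠ c) → J.card ≤ M}

theorem isClosed_sparseSequences {n : ℕ} (c : Fin n) (M : ℕ) :
    IsClosed (sparseSequences c M) := by
  rw [← isOpen_compl_iff, isOpen_iff_mem_nhds]
  intro x hx
  simp only [sparseSequences, mem_compl_iff, mem_ofPred_eq, not_forall] at hx
  obtain ⟨J, hJ, hcard⟩ := hx
  have ho : IsOpen (⋂ i ∈ J, (fun y : ℤ → Fin n => y i) ⁻¹' {c}ᶜ) :=
    isOpen_biInter_finset fun i _ => (isOpen_discrete _).preimage (continuous_apply i)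
  refine mem_of_superset (ho.mem_nhds (mem_iInter₂.2 hJ)) fun y hy hy' => ?_
  exact hcard (hy' J (mem_iInter₂.1 hy))

/-- A cylinder fixes finitely many coordinates; all others may be given a symbol `d ≠ c`. -/
theorem interior_sparseSequences {n : ℕ} (hn : 2 ≤ n) (c : Fin n) (M : ℕ) :
    interior (sparseSequences c M) = ∅ := by
  rw [eq_empty_iff_forall_notMem]
  intro x hx
  obtain ⟨I, hI⟩ := exists_finset_agree_subset isOpen_interior hx
  have : Nontrivial (Fin n) := Fin.nontrivial_iff_two_le.2 hn
  obtain ⟨d, hd⟩ := exists_ne c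
  obtain ⟨J, hJ, hcard⟩ := (I.finite_toSet.infinite_compl).exists_subset_card_eq (M + 1)
  have h1 := interior_subset (hI (fun i => if i ∈ I then x i else d) fun i hi => if_pos hi)
  have h2 := h1 J fun i hi => by
    have : i ∉ I := hJ hi
    simpa [this] using hd
  omega

theorem fullShift_image_sparseSequences {n : ℕ} (c : Fin n) (M : ℕ) :
    fullShift n '' sparseSequences c M = sparseSequences c M := by
  have shift : ∀ (x y : ℤ → Fin n) (d : ℤ), (∀ i, y i = x (i + d)) →
      x ∈ sparseSequences c M → y ∈ sparseSequences c M := by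
    intro x y d hxy hx J hJ
    rw [← Finset.card_map (addRightEmbedding d)]
    refine hx _ fun i hi => ?_
    obtain ⟨j, hj, rfl⟩ := Finset.mem_map.1 hi
    have := hJ j hj
    rwa [hxy] at this
  refine Subset.antisymm ?_ fun x hx => ?_
  · rintro _ ⟨x, hx, rfl⟩
    exact shift x _ 1 (fun i => rfl) hx
  · exact ⟨(fullShift n).symm x, shift x _ (-1) (fun i => rfl) hx,
      (fullShift n).apply_symm_apply x⟩

/-- Put the pattern of `U` on `I`, that of `V` on `J + m`, and `c` elsewhere. At most `I.card +
J.card` entries differ from `c`, whatever `m` is, so one sparse set serves all large `m`. -/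
theorem mixesAlongNowhereDense_fullShift {n : ℕ} (hn : 2 ≤ n) :
    MixesAlongNowhereDense (fullShift n) := by
  rintro U V hU hV ⟨x, hx⟩ ⟨y, hy⟩
  obtain ⟨I, hI⟩ := exists_finset_agree_subset hU hx
  obtain ⟨J, hJ⟩ := exists_finset_agree_subset hV hy
  set c : Fin n := ⟨0, by omega⟩
  -- The translate `J + m` meets `I` for only finitely many `m`.
  have hfin : {m : ℕ | ∃ i ∈ I, ∃ j ∈ J, i = j + m}.Finite := by
    refine (((I ×ˢ J).image fun p => (p.1 - p.2).toNat).finite_toSet).subset ?_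
    rintro m ⟨i, hi, j, hj, hm⟩
    exact Finset.mem_coe.2 (Finset.mem_image.2
      ⟨(i, j), Finset.mem_product.2 ⟨hi, hj⟩, by simp [hm]⟩)
  obtain ⟨N, hN⟩ := hfin.bddAbove
  have hcl := isClosed_sparseSequences c (I.card + J.card)
  refine ⟨sparseSequences c (I.card + J.card), N + 1, hcl.isCompact,
    hcl.isNowhereDense_iff.2 (interior_sparseSequences hn c _),
    fullShift_image_sparseSequences c _, fun m hm => ?_⟩
  have hdisj : ∀ j ∈ J, j + m ∉ I := fun j hj hjI => by
    have : m ≤ N := hN ⟨j + m, hjI, j, hj, rfl⟩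
    omega
  set z : ℤ → Fin n := fun i => if i ∈ I then x i else if i - m ∈ J then y (i - m) else c with hz
  refine ⟨_, ⟨z, ⟨fun P hP => ?_, hI z fun i hi => if_pos hi⟩, rfl⟩, hJ _ fun j hj => ?_⟩
  · have hsub : P ⊆ I ∪ J.map (addRightEmbedding (m : ℤ)) := by
      intro i hi
      have hne := hP i hi
      by_contra hmem
      simp only [Finset.mem_union, Finset.mem_map, not_or, not_exists, not_and] at hmem
      have h2 : i - m ∉ J := fun hj => hmem.2 _ hj (by simp)
      exact hne (by simp [hz, hmem.1, h2])
    calc P.card ≤ _ := Finset.card_le_card hsub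
      _ ≤ _ := Finset.card_union_le _ _
      _ = _ := by rw [Finset.card_map]
  · rw [fullShift_iterate_apply]
    simp [hz, hdisj j hj, hj]

end Shift

theorem theorem7p5 :
    (∀ (C : Type*) [TopologicalSpace C], IsCantorSpace C →
      ∀ h : C ≃ₜ C, IsTopMixing h → MixesAlongNowhereDense h →
        ∃ Φ : FencePair C, Φ.IsLelek ∧
          ∃ T : Φ.fence ≃ₜ Φ.fence, Φ.IsLifting T h ∧ IsTopMixing T) ∧
    (∀ n : ℕ, 2 ≤ n →
      IsCantorSpace (ℤ → Fin n) ∧ IsTopMixing (fullShift n) ∧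
        MixesAlongNowhereDense (fullShift n)) :=
  ⟨fun _ _ hC h _ hmix => exists_lelek_mixing_lifting hC h hmix, fun _ hn =>
    ⟨isCantorSpace_int_fin hn, .of_mixesAlongNowhereDense (mixesAlongNowhereDense_fullShift hn),
      mixesAlongNowhereDense_fullShift hn⟩⟩
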